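/- A rooted tree with $n$ nodes means a tree on the vertex set $[n]=\{1,\dots,n\}$ with a distinguished vertex, its root; a rooted forest with $n$ nodes means an acyclic graph on $[n]$ with one distinguished vertex, the root, in each connected component (there is exactly one rooted forest with $0$ nodes and no rooted tree with $0$ nodes). A node of a rooted tree is a record if its label is the largest label on the unique path from the root to that node; a node of a rooted forest is a record if it is a record of the tree containing it. For integers $n,k\ge 0$ let $R_\bullet(n,k)$ be the number of rooted trees with $n$ nodes and exactly $k$ records, and let $R(n,k)$ be the number of rooted forests with $n$ nodes and exactly $k$ records. Proposition. The tree record numbers satisfy $$R_\bullet(n,k)=\sum_{i=k-1}^{n-1}\binom{n-1}{i}\,R_\bullet(i,k-1)\,(n-i)^{n-i-2}\,i\qquad (n\ge 1,\ 2\le k\le n),$$ $R_\bullet(n,1)=n^{n-2}$ for all $n\ge 1$, and $R_\bullet(n,k)=0$ in all other cases. The forest record numbers satisfy $$R(n,k)=\sum_{i=k-1}^{n-1}\binom{n-1}{i}\,R(i,k-1)\,(n-i)^{n-i-2}\,(i+1)\qquad (n\ge 1,\ 1\le k\le n),$$ $R(0,0)=1$, and $R(n,k)=0$ in all other cases. (Here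 $1^{-1}=1$.) -/

import Mathlib

/-- A rooted tree on the vertex set `V`: a tree with a distinguished vertex. -/
@[ext]
structure LabelledRootedTree (V : Type*) where
  /-- the underlying tree -/
  graph : SimpleGraph V
  /-- the root -/
  root : V
  isTree : graph.IsTree

/-- A rooted forest on the vertex set `V`: an acyclic graph with a set of roots that has exactly
one element in each connected component (every vertex is connected to exactly one root).
The empty vertex set carries exactly one rooted forest. -/
@[ext]
structure LabelledRootedForest (V : Type*) where
  /-- the underlying acyclic graph -/
  graph : SimpleGraph V
  /-- the set of roots -/
  roots : Set V
  isAcyclic : graph.IsAcyclic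
  existsUnique_root : ∀ v, ∃! r, r ∈ roots ∧ graph.Reachable r v

instance LabelledRootedTree.finite (V : Type*) [Finite V] : Finite (LabelledRootedTree V) :=
  Finite.of_injective (fun T => (T.graph, T.root)) fun _ _ h =>
    LabelledRootedTree.ext (congrArg Prod.fst h) (congrArg Prod.snd h)

instance LabelledRootedForest.finite (V : Type*) [Finite V] : Finite (LabelledRootedForest V) :=
  Finite.of_injective (fun F => (F.graph, F.roots)) fun _ _ h =>
    LabelledRootedForest.ext (congrArg Prod.fst h) (congrArg Prod.snd h)

/-- The vertex `v` is a record of the rooted tree `T` if its label is the largest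
along the unique path from the root to `v`. -/
def LabelledRootedTree.IsRecord {V : Type*} [LinearOrder V] (T : LabelledRootedTree V) (v : V) : Prop :=
  ∃ p : T.graph.Walk T.root v, p.IsPath ∧ ∀ u ∈ p.support, u ≤ v

/-- The vertex `v` is a record of the rooted forest `F` if its label is the largest
along the unique path to `v` from the root of its tree. -/
def LabelledRootedForest.IsRecord {V : Type*} [LinearOrder V] (F : LabelledRootedForest V) (v : V) : Prop :=
  ∃ r ∈ F.roots, ∃ p : F.graph.Walk r v, p.IsPath ∧ ∀ u ∈ p.support, u ≤ v

/-- The tree record number: the number of rooted trees with `n` labelled nodes and `k` records.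
The labels are the elements of `Fin n` with their usual order. -/
noncomputable def treeRecordNumber (n k : ℕ) : ℕ :=
  Nat.card {T : LabelledRootedTree (Fin n) // {v | T.IsRecord v}.ncard = k}

/-- The forest record number: the number of rooted forests with `n` labelled nodes and
`k` records. The labels are the elements of `Fin n` with their usual order. -/
noncomputable def forestRecordNumber (n k : ℕ) : ℕ :=
  Nat.card {F : LabelledRootedForest (Fin n) // {v | F.IsRecord v}.ncard = k}

/-! Cut a rooted forest at its largest vertex `⊤`. Let `U` be the set of non-descendants of `⊤`. The
forest restricts to a rooted forest on `U`, the proper descendants of `⊤` form a rooted forest hung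
below `⊤`, and `⊤` is either a root or attached to a vertex of `U`. These data are arbitrary
(`graft_injective`, `graft_surjective`). The vertex `⊤` is always a record, its proper descendants
never are, and a vertex of `U` keeps its ancestors, hence its status (`records_graft`). With `i =
|U|` there are `(n-1).choose i` sets `U`, `i + 1` positions for `⊤`, and `(n-i)^(n-i-2)` forests on
the `n-1-i` descendants: this is the forest recursion. For a tree with `i > 0`, `⊤` cannot be a
root, which leaves `i` positions; `i = 0` forces exactly one record. The forest count `(m+1)^(m-1)`
comes from the same decomposition with all weights 1, combined with Abel's identity (`card_fin`,
`abel_binomial`). Forests are handled as well-founded parent maps, shown equivalent to the graph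
definition by `toForest_bijective`. -/

open Relation

/-! ### Parent maps and their equivalence with rooted forests -/

/-- A rooted forest on `V`, presented by the map sending each non-root to its parent. -/
@[ext]
structure ParentMap (V : Type*) where
  /-- the parent of a vertex, `none` at the roots -/
  parent : V → Option V
  wf : WellFounded fun u v => parent v = some u

namespace ParentMap

variable {V : Type*} (f : ParentMap V)

instance finite [Finite V] : Finite (ParentMap V) :=
  Finite.of_injective parent fun _ _ h => ParentMap.ext h

/-- `f.Descends v u` says that `u` is an ancestor of `v` or `v` itself. -/
def Descends (v u : V) : Prop := ReflTransGen (fun a b => f.parent a = some b) v u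

/-- The roots of a parent map. -/
def roots : Set V := {v | f.parent v = none}

/-- The vertices that are at least as large as all their ancestors. -/
def records [LE V] : Set V := {v | ∀ u, f.Descends v u → u ≤ v}

/-- The graph whose edges join each vertex to its parent. -/
def graph : SimpleGraph V where
  Adj a b := f.parent a = some b ∨ f.parent b = some a
  symm := ⟨fun _ _ h => h.symm⟩
  loopless := ⟨fun a h => by
    have h' : f.parent a = some a := by simpa using h
    exact f.wf.asymmetric _ _ h' h'⟩

variable {f}

theorem parent_ne_some_of_parent_eq_some {a b : V} (h : f.parent a = some b) :
    f.parent b ≠ some a :=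
  fun h' => f.wf.asymmetric _ _ h h'

theorem Descends.eq_or_exists {v u : V} (h : f.Descends v u) :
    v = u ∨ ∃ w, f.parent v = some w ∧ f.Descends w u := by
  rcases ReflTransGen.cases_head h with h | ⟨w, h₁, h₂⟩
  · exact Or.inl h
  · exact Or.inr ⟨w, h₁, h₂⟩

theorem Descends.of_parent {v w u : V} (h : f.parent v = some w) (hw : f.Descends w u) :
    f.Descends v u :=
  ReflTransGen.head h hw

theorem Descends.refl (v : V) : f.Descends v v := ReflTransGen.refl

theorem not_descends_of_parent {v w : V} (h : f.parent v = some w) : ¬ f.Descends w v := by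
  intro hw
  have hcyc : TransGen (fun a b => f.parent a = some b) v v := TransGen.head' h hw
  have hwf := f.wf.transGen
  have hcyc' : TransGen (fun u v => f.parent v = some u) v v := by
    rw [← transGen_swap] at hcyc
    exact hcyc
  exact hwf.asymmetric _ _ hcyc' hcyc'

theorem Descends.eq_of_mem_roots {r u : V} (hr : r ∈ f.roots) (h : f.Descends r u) : r = u := by
  rcases h.eq_or_exists with h | ⟨w, h, -⟩
  · exact h
  · exact absurd (hr.symm.trans h) (by simp)

/-- The descendants of `u` are closed under adjacency, except for the edge above `u`. -/
theorem Descends.of_adj {u x y : V} (hx : f.Descends x u) (h : f.graph.Adj x y)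
    (hne : x = u → f.parent x ≠ some y) : f.Descends y u := by
  rcases h with h | h
  · rcases hx.eq_or_exists with rfl | ⟨w, hw, hwu⟩
    · exact absurd h (hne rfl)
    · obtain rfl : y = w := by simpa [h] using hw
      exact hwu
  · exact .of_parent h hx

theorem Descends.exists_walk {v u : V} (h : f.Descends v u) :
    ∃ p : f.graph.Walk u v, ∀ w ∈ p.support, f.Descends v w := by
  induction h with
  | refl => exact ⟨.nil, by simp [Descends.refl]⟩
  | @tail b c hb hc ih =>
    obtain ⟨p, hp⟩ := ih
    refine ⟨.cons (Or.inr hc) p, ?_⟩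
    intro w hw
    rcases List.mem_cons.1 (SimpleGraph.Walk.support_cons _ _ ▸ hw) with rfl | hw
    · exact ReflTransGen.tail hb hc
    · exact hp w hw

theorem exists_root (v : V) : ∃ r ∈ f.roots, f.Descends v r := by
  induction v using f.wf.induction with
  | _ v ih =>
    rcases h : f.parent v with _ | w
    · exact ⟨v, h, .refl v⟩
    · obtain ⟨r, hr, hw⟩ := ih w h
      exact ⟨r, hr, .of_parent h hw⟩

theorem Descends.of_reachable {r v : V} (hr : r ∈ f.roots) (h : f.graph.Reachable r v) :
    f.Descends v r := by
  suffices ∀ {x y : V} (p : f.graph.Walk x y), f.Descends x r → f.Descends y r by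
    obtain ⟨p⟩ := h
    exact this p (.refl r)
  intro x y p
  induction p with
  | nil => exact id
  | cons hadj p ih =>
    refine fun hx => ih (hx.of_adj hadj ?_)
    rintro rfl h
    exact absurd (hr.symm.trans h) (by simp)

theorem Descends.reachable {v u : V} (h : f.Descends v u) : f.graph.Reachable u v :=
  let ⟨p, _⟩ := h.exists_walk
  ⟨p⟩

theorem Descends.root_unique {v r s : V} (hr : r ∈ f.roots) (hs : s ∈ f.roots)
    (h : f.Descends v r) (h' : f.Descends v s) : r = s := by
  have hu : Relator.RightUnique (fun a b => f.parent a = some b) := fun a b c hb hc => by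
    simpa [hb] using hc
  rcases ReflTransGen.total_of_right_unique hu h h' with h | h
  · exact Descends.eq_of_mem_roots hr h
  · exact (Descends.eq_of_mem_roots hs h).symm

/-- Every edge from `a` to its parent is a bridge: once it is deleted, the descendants of `a` are
closed under adjacency, and the parent is not among them. -/
theorem isAcyclic_graph (f : ParentMap V) : f.graph.IsAcyclic := by
  rw [SimpleGraph.isAcyclic_iff_forall_adj_isBridge]
  have key : ∀ a b, f.parent a = some b → f.graph.IsBridge s(a, b) := by
    intro a b hab
    rw [SimpleGraph.isBridge_iff]
    rintro ⟨p⟩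
    suffices ∀ {x y : V} (p : (f.graph.deleteEdges {s(a, b)}).Walk x y),
        f.Descends x a → f.Descends y a from
      not_descends_of_parent hab (this p (.refl a))
    intro x y p
    induction p with
    | nil => exact id
    | cons hadj p ih =>
      rw [SimpleGraph.deleteEdges_adj] at hadj
      refine fun hx => ih (hx.of_adj hadj.1 ?_)
      rintro rfl h
      obtain rfl : b = _ := by simpa [hab] using h
      exact hadj.2 rfl
  rintro v w (h | h)
  · exact key v w h
  · rw [Sym2.eq_swap]
    exact key w v h

/-- The rooted forest described by a parent map. -/
def toForest (f : ParentMap V) : LabelledRootedForest V where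
  graph := f.graph
  roots := f.roots
  isAcyclic := f.isAcyclic_graph
  existsUnique_root v := by
    obtain ⟨r, hr, h⟩ := f.exists_root v
    refine ⟨r, ⟨hr, h.reachable⟩, ?_⟩
    rintro s ⟨hs, h'⟩
    exact Descends.root_unique hs hr (.of_reachable hs h') h

/-- Induction from the roots outwards: the edge from `v` to its parent `w` must be directed the same
way in `g`, since otherwise `v` would be the parent of `w` in `g`, hence by induction in `f`. -/
theorem toForest_injective : Function.Injective (toForest : ParentMap V → _) := by
  intro f g h
  have hG : f.graph = g.graph := congrArg LabelledRootedForest.graph h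
  have hR : f.roots = g.roots := congrArg LabelledRootedForest.roots h
  ext1
  funext v
  induction v using f.wf.induction with
  | _ v ih =>
    rcases hv : f.parent v with _ | w
    · have : v ∈ g.roots := hR ▸ hv
      exact this.symm
    · have hadj : g.graph.Adj v w := hG ▸ Or.inl hv
      rcases hadj with h | h
      · exact h.symm
      · exact absurd ((ih w hv).trans h) (parent_ne_some_of_parent_eq_some hv)

theorem toForest_surjective : Function.Surjective (toForest : ParentMap V → _) := by
  intro F
  choose root hroot huniq using F.existsUnique_root
  -- The parent is the penultimate vertex of a shortest walk from the root; the decreasing distance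
  -- gives well-foundedness.
  have hstep : ∀ v, v ∉ F.roots →
      ∃ u, F.graph.Adj u v ∧ F.graph.dist (root u) u < F.graph.dist (root v) v := by
    intro v hv
    obtain ⟨p, hp⟩ := (hroot v).2.exists_walk_length_eq_dist
    have hnil : ¬ p.Nil := fun h => hv (h.eq ▸ (hroot v).1)
    refine ⟨p.penultimate, p.adj_penultimate hnil, ?_⟩
    have hr : root v = root p.penultimate :=
      huniq _ _ ⟨(hroot v).1, ⟨p.dropLast⟩⟩
    rw [← hr, ← hp]
    refine (SimpleGraph.dist_le p.dropLast).trans_lt ?_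
    have := p.length_dropLast_add_one hnil
    omega
  classical
  choose! par hadj hlt using hstep
  let f : ParentMap V :=
    { parent := fun v => if v ∈ F.roots then none else some (par v)
      wf := by
        refine Subrelation.wf (r := InvImage (· < ·) fun v => F.graph.dist (root v) v) ?_
          (InvImage.wf _ wellFounded_lt)
        intro u v h
        by_cases hv : v ∈ F.roots
        · simp [hv] at h
        · obtain rfl : par v = u := by simpa [hv] using h
          exact hlt v hv }
  have hfr : f.roots = F.roots := by
    ext v
    by_cases hv : v ∈ F.roots <;> simp [roots, f, hv]
  have hle : f.graph ≤ F.graph := by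
    have : ∀ a b, f.parent a = some b → F.graph.Adj a b := by
      intro a b h
      by_cases hv : a ∈ F.roots
      · simp [f, hv] at h
      · obtain rfl : par a = b := by simpa [f, hv] using h
        exact (hadj a hv).symm
    rintro a b (h | h)
    · exact this a b h
    · exact (this b a h).symm
  have hreach : ∀ v, f.graph.Reachable (root v) v := by
    intro v
    obtain ⟨r, hr, h⟩ := f.exists_root v
    rw [← huniq v r ⟨hfr ▸ hr, h.reachable.mono hle⟩]
    exact h.reachable
  refine ⟨f, LabelledRootedForest.ext (le_antisymm hle ?_) hfr⟩
  intro a b hab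
  -- The parent edges already connect each vertex to its root, so an edge of `F` outside them would
  -- not be a bridge.
  by_contra hnot
  have hb := SimpleGraph.isAcyclic_iff_forall_adj_isBridge.1 F.isAcyclic hab
  rw [SimpleGraph.isBridge_iff] at hb
  have hr : root a = root b := huniq _ _ ⟨(hroot a).1, (hroot a).2.trans hab.reachable⟩
  refine hb (SimpleGraph.Reachable.mono ?_ ((hreach a).symm.trans (hr ▸ hreach b)))
  intro x y hxy
  rw [SimpleGraph.deleteEdges_adj]
  refine ⟨hle hxy, fun h => hnot ?_⟩
  rcases Sym2.eq_iff.1 (Set.mem_singleton_iff.1 h) with ⟨rfl, rfl⟩ | ⟨rfl, rfl⟩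
  · exact hxy
  · exact hxy.symm

/-- A walk ending at a descendant of `u` starts at a descendant of `u` or visits `u`. -/
theorem Descends.mem_support_or {u x y : V} (p : f.graph.Walk x y) (h : f.Descends y u) :
    u ∈ p.support ∨ f.Descends x u := by
  induction p with
  | nil => exact Or.inr h
  | @cons x y z hadj p ih =>
    rw [SimpleGraph.Walk.support_cons, List.mem_cons]
    rcases ih h with h | h
    · exact Or.inl (Or.inr h)
    · by_cases hy : y = u
      · subst hy
        exact Or.inl (Or.inr p.start_mem_support)
      · exact Or.inr (h.of_adj hadj.symm fun h => absurd h hy)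

/-- Every walk from the root to `v` visits all ancestors of `v`, and some walk visits only ancestors
of `v`; shortcutting the latter gives a path. -/
theorem isRecord_toForest_iff [LinearOrder V] (f : ParentMap V) (v : V) :
    f.toForest.IsRecord v ↔ v ∈ f.records := by
  classical
  constructor
  · rintro ⟨r, hr, p, -, hp⟩ u hu
    rcases Descends.mem_support_or p hu with h | h
    · exact hp u h
    · rw [← Descends.eq_of_mem_roots hr h]
      exact hp r p.start_mem_support
  · intro h
    obtain ⟨r, hr, hd⟩ := f.exists_root v
    obtain ⟨p, hp⟩ := hd.exists_walk
    exact ⟨r, hr, p.bypass, p.bypass_isPath,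
      fun u hu => h u (hp u (p.support_bypass_subset_support hu))⟩

theorem setOf_isRecord_toForest [LinearOrder V] (f : ParentMap V) :
    {v | f.toForest.IsRecord v} = f.records :=
  Set.ext f.isRecord_toForest_iff

theorem toForest_bijective : Function.Bijective (toForest : ParentMap V → _) :=
  ⟨toForest_injective, toForest_surjective⟩

end ParentMap

/-! ### Trees as one-rooted forests; record numbers as counts of parent maps -/

/-- A rooted tree as a rooted forest. -/
def LabelledRootedTree.toForest {V : Type*} (T : LabelledRootedTree V) :
    LabelledRootedForest V where
  graph := T.graph
  roots := {T.root}
  isAcyclic := T.isTree.isAcyclic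
  existsUnique_root _ := ⟨T.root, ⟨rfl, T.isTree.connected _ _⟩, fun _ h => h.1⟩

theorem LabelledRootedTree.toForest_injective {V : Type*} :
    Function.Injective (toForest : LabelledRootedTree V → _) := by
  intro S T h
  exact LabelledRootedTree.ext (congrArg LabelledRootedForest.graph h)
    (Set.singleton_injective (congrArg LabelledRootedForest.roots h))

theorem LabelledRootedTree.exists_toForest_eq {V : Type*} (F : LabelledRootedForest V)
    (h : F.roots.ncard = 1) : ∃ T : LabelledRootedTree V, T.toForest = F := by
  obtain ⟨r, hr⟩ := Set.ncard_eq_one.1 h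
  have hreach : ∀ v, F.graph.Reachable r v := by
    intro v
    obtain ⟨s, ⟨hs, hv⟩, -⟩ := F.existsUnique_root v
    obtain rfl : s = r := by simpa [hr] using hs
    exact hv
  have : Nonempty V := ⟨r⟩
  exact ⟨⟨F.graph, r, ⟨⟨fun u v => (hreach u).symm.trans (hreach v)⟩, F.isAcyclic⟩⟩,
    LabelledRootedForest.ext rfl hr.symm⟩

theorem LabelledRootedTree.isRecord_toForest_iff {V : Type*} [LinearOrder V]
    (T : LabelledRootedTree V) (v : V) : T.toForest.IsRecord v ↔ T.IsRecord v :=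
  ⟨fun ⟨_, hr, h⟩ => by cases hr; exact h, fun h => ⟨T.root, rfl, h⟩⟩

theorem forestRecordNumber_eq_card (n k : ℕ) :
    forestRecordNumber n k = Nat.card {f : ParentMap (Fin n) // f.records.ncard = k} := by
  refine (Nat.card_congr ((Equiv.ofBijective _ ParentMap.toForest_bijective).subtypeEquiv
    fun f => ?_)).symm
  rw [← f.setOf_isRecord_toForest]
  rfl

theorem treeRecordNumber_eq_card (n k : ℕ) :
    treeRecordNumber n k =
      Nat.card {f : ParentMap (Fin n) // f.records.ncard = k ∧ f.roots.ncard = 1} := by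
  have h₁ : Nat.card {f : ParentMap (Fin n) // f.records.ncard = k ∧ f.roots.ncard = 1} =
      Nat.card {F : LabelledRootedForest (Fin n) //
        {v | F.IsRecord v}.ncard = k ∧ F.roots.ncard = 1} := by
    refine Nat.card_congr ((Equiv.ofBijective _ ParentMap.toForest_bijective).subtypeEquiv
      fun f => ?_)
    rw [← f.setOf_isRecord_toForest]
    rfl
  rw [h₁]
  refine Nat.card_congr (Equiv.ofBijective
    (fun T => ⟨T.1.toForest, ?_, Set.ncard_singleton T.1.root⟩) ⟨?_, ?_⟩)
  · simpa [LabelledRootedTree.isRecord_toForest_iff] using T.2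
  · intro S T h
    exact Subtype.ext (LabelledRootedTree.toForest_injective (congrArg Subtype.val h))
  · rintro ⟨F, hF, hr⟩
    obtain ⟨T, rfl⟩ := LabelledRootedTree.exists_toForest_eq F hr
    exact ⟨⟨T, by simpa [LabelledRootedTree.isRecord_toForest_iff] using hF⟩, rfl⟩

/-! ### Relabelling -/

namespace ParentMap

section Congr

variable {V W : Type*}

/-- Relabelling of a parent map. -/
def map (e : V ≃ W) (f : ParentMap V) : ParentMap W where
  parent w := (f.parent (e.symm w)).map e
  wf := by
    refine Subrelation.wf (r := InvImage (fun u v => f.parent v = some u) e.symm) ?_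
      (InvImage.wf _ f.wf)
    intro u v h
    obtain ⟨x, hx, rfl⟩ := Option.map_eq_some_iff.1 h
    simpa [InvImage] using hx

theorem map_parent_apply (e : V ≃ W) (f : ParentMap V) (v : V) :
    (f.map e).parent (e v) = (f.parent v).map e := by
  simp [map]

/-- Relabelling as an equivalence. -/
def congr (e : V ≃ W) : ParentMap V ≃ ParentMap W where
  toFun := map e
  invFun := map e.symm
  left_inv f := by ext1; funext v; simp [map]
  right_inv f := by ext1; funext v; simp [map]

theorem Descends.lift {f : ParentMap V} {g : ParentMap W} (e : V → W)
    (h : ∀ a b, f.parent a = some b → g.parent (e a) = some (e b)) {v u : V}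
    (hd : f.Descends v u) : g.Descends (e v) (e u) :=
  ReflTransGen.lift e (fun a b => h a b) v u hd

theorem descends_map_iff (e : V ≃ W) (f : ParentMap V) (v u : V) :
    (f.map e).Descends (e v) (e u) ↔ f.Descends v u := by
  constructor
  · intro h
    have := h.lift (g := f) e.symm fun a b hab => by
      obtain ⟨x, hx, rfl⟩ := Option.map_eq_some_iff.1 hab
      simpa using hx
    simpa using this
  · exact fun h => h.lift e fun a b hab => by rw [map_parent_apply, hab, Option.map_some]

theorem roots_map (e : V ≃ W) (f : ParentMap V) : (f.map e).roots = e '' f.roots := by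
  ext w
  obtain ⟨v, rfl⟩ := e.surjective w
  simp [roots, map_parent_apply]

theorem records_map [LE V] [LE W] (e : V ≃o W) (f : ParentMap V) :
    (f.map e.toEquiv).records = e '' f.records := by
  ext w
  obtain ⟨v, rfl⟩ := e.surjective w
  rw [e.injective.mem_set_image]
  constructor
  · intro h u hu
    exact e.le_iff_le.1 (h (e u) ((descends_map_iff e.toEquiv f v u).2 hu))
  · intro h u hu
    obtain ⟨u, rfl⟩ := e.surjective u
    exact e.le_iff_le.2 (h u ((descends_map_iff e.toEquiv f v u).1 hu))

end Congr

/-! ### Decomposition at the largest vertex -/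

section Graft

variable {W : Type*} {U : Finset W}

/-- The inclusion of a subtype of `W` into `WithTop W`. -/
def toTop {P : W → Prop} (u : {w // P w}) : WithTop W := ((u : W) : WithTop W)

theorem toTop_injective {P : W → Prop} : Function.Injective (toTop : {w // P w} → WithTop W) :=
  fun _ _ h => Subtype.ext (WithTop.coe_injective h)

theorem toTop_ne_top {P : W → Prop} (u : {w // P w}) : toTop u ≠ ⊤ := WithTop.coe_ne_top

theorem top_notMem_image_toTop {P : W → Prop} {s : Set {w // P w}} : ⊤ ∉ toTop '' s :=
  fun ⟨u, _, hu⟩ => toTop_ne_top u hu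

open Classical in
/-- The parent map on `WithTop W` in which the top vertex is attached below `p`, the vertices of
`Uᶜ` form the forest `h` below the top vertex, and the vertices of `U` form the forest `g`. -/
noncomputable def graftParent (g : ParentMap U) (p : Option U)
    (h : ParentMap {w // w ∉ U}) : WithTop W → Option (WithTop W)
  | none => p.map toTop
  | some w =>
    if hw : w ∈ U then (g.parent ⟨w, hw⟩).map toTop
    else some ((h.parent ⟨w, hw⟩).elim ⊤ toTop)

variable (g : ParentMap U) (p : Option U) (h : ParentMap {w // w ∉ U})

theorem graftParent_top : graftParent g p h ⊤ = p.map toTop := rfl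

theorem graftParent_mem (u : U) :
    graftParent g p h (toTop u) =
      (g.parent u).map toTop :=
  dif_pos u.2

theorem graftParent_notMem (u : {w // w ∉ U}) :
    graftParent g p h (toTop u) =
      some ((h.parent u).elim ⊤ toTop) :=
  dif_neg u.2

/-- Parents never lead back along the order `U`, then `⊤`, then the complement of `U`, so
accessibility is proved in that order. -/
theorem graftParent_wf : WellFounded fun u v => graftParent g p h v = some u := by
  have h₁ : ∀ u : U, Acc (fun u v => graftParent g p h v = some u) (toTop u) := by
    intro u
    induction u using g.wf.induction with
    | _ u ih =>
      refine ⟨_, fun v hv => ?_⟩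
      rw [graftParent_mem] at hv
      obtain ⟨x, hx, rfl⟩ := Option.map_eq_some_iff.1 hv
      exact ih x hx
  have h₂ : Acc (fun u v => graftParent g p h v = some u) ⊤ := by
    refine ⟨_, fun v hv => ?_⟩
    rw [graftParent_top] at hv
    obtain ⟨x, hx, rfl⟩ := Option.map_eq_some_iff.1 hv
    exact h₁ x
  have h₃ : ∀ u : {w // w ∉ U},
      Acc (fun u v => graftParent g p h v = some u) (toTop u) := by
    intro u
    induction u using h.wf.induction with
    | _ u ih =>
      refine ⟨_, fun v hv => ?_⟩
      rw [graftParent_notMem, Option.some_inj] at hv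
      rcases hx : h.parent u with _ | x
      · rw [hx] at hv
        exact hv ▸ h₂
      · rw [hx] at hv
        exact hv ▸ ih x hx
  refine ⟨fun v => ?_⟩
  induction v using WithTop.recTopCoe with
  | top => exact h₂
  | coe w =>
    by_cases hw : w ∈ U
    · exact h₁ ⟨w, hw⟩
    · exact h₃ ⟨w, hw⟩

/-- The parent map given by `graftParent`. -/
noncomputable def graft : ParentMap (WithTop W) := ⟨graftParent g p h, graftParent_wf g p h⟩

theorem descends_graft_mem_iff (u : U) (v : WithTop W) :
    (graft g p h).Descends (toTop u) v ↔
      ∃ x : U, g.Descends u x ∧ (toTop x) = v := by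
  constructor
  · intro hd
    induction hd with
    | refl => exact ⟨u, .refl u, rfl⟩
    | tail _ hc ih =>
      obtain ⟨x, hx, rfl⟩ := ih
      have hc' := (graftParent_mem g p h x).symm.trans hc
      obtain ⟨y, hy, rfl⟩ := Option.map_eq_some_iff.1 hc'
      exact ⟨y, ReflTransGen.tail hx hy, rfl⟩
  · rintro ⟨x, hx, rfl⟩
    refine hx.lift toTop fun a b hab => ?_
    exact (graftParent_mem g p h a).trans (by rw [hab, Option.map_some])

theorem descends_graft_top (u : {w // w ∉ U}) :
    (graft g p h).Descends (toTop u) ⊤ := by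
  induction u using h.wf.induction with
  | _ u ih =>
    have hu := graftParent_notMem g p h u
    rcases hx : h.parent u with _ | x
    · rw [hx] at hu
      exact ReflTransGen.single hu
    · rw [hx] at hu
      exact ReflTransGen.head hu (ih x hx)

/-- This recovers `U` from the assembled forest, which is what makes the decomposition unique. -/
theorem descends_graft_top_iff (w : W) : (graft g p h).Descends w ⊤ ↔ w ∉ U := by
  constructor
  · intro hd hw
    obtain ⟨x, -, hx⟩ := (descends_graft_mem_iff g p h ⟨w, hw⟩ _).1 hd
    exact WithTop.coe_ne_top hx
  · exact fun hw => descends_graft_top g p h ⟨w, hw⟩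

theorem records_graft [LinearOrder W] :
    (graft g p h).records =
      insert ⊤ (toTop '' g.records) := by
  ext v
  induction v using WithTop.recTopCoe with
  | top => simp [records]
  | coe w =>
    by_cases hw : w ∈ U
    · have h₁ : (w : WithTop W) ∈ toTop '' g.records ↔
          (⟨w, hw⟩ : U) ∈ g.records :=
        toTop_injective.mem_set_image (a := (⟨w, hw⟩ : U))
      rw [Set.mem_insert_iff, h₁, or_iff_right WithTop.coe_ne_top]
      constructor
      · intro hr u hu
        exact (WithTop.coe_le_coe (a := w) (b := (u : W))).1
          (hr (toTop u) ((descends_graft_mem_iff g p h ⟨w, hw⟩ _).2 ⟨u, hu, rfl⟩))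
      · intro hr v hv
        obtain ⟨x, hx, rfl⟩ := (descends_graft_mem_iff g p h ⟨w, hw⟩ _).1 hv
        exact WithTop.coe_le_coe.2 (hr x hx)
    · constructor
      · intro hr
        have := hr ⊤ (descends_graft_top g p h ⟨w, hw⟩)
        exact absurd (top_le_iff.1 this) WithTop.coe_ne_top
      · rintro (hr | ⟨u, -, hu⟩)
        · exact absurd hr WithTop.coe_ne_top
        · exact absurd (WithTop.coe_injective hu ▸ u.2) hw

theorem ncard_records_graft [LinearOrder W] :
    (graft g p h).records.ncard = g.records.ncard + 1 := by
  rw [records_graft, Set.ncard_insert_of_notMem top_notMem_image_toTop (Set.toFinite _),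
    Set.ncard_image_of_injective _ toTop_injective]

theorem coe_mem_roots_graft_iff (v : WithTop W) (hv : v ≠ ⊤) :
    v ∈ (graft g p h).roots ↔ v ∈ toTop '' g.roots := by
  induction v using WithTop.recTopCoe with
  | top => exact absurd rfl hv
  | coe w =>
    by_cases hw : w ∈ U
    · refine Iff.trans ?_ (toTop_injective.mem_set_image (a := (⟨w, hw⟩ : U))).symm
      refine Iff.trans ?_ (Option.map_eq_none_iff (f := toTop))
      rw [← graftParent_mem g p h ⟨w, hw⟩]
      rfl
    · constructor
      · intro hr
        have := (graftParent_notMem g p h ⟨w, hw⟩).symm.trans hr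
        simp at this
      · rintro ⟨u, -, hu⟩
        exact absurd (WithTop.coe_injective hu ▸ u.2) hw

theorem ncard_roots_graft_none :
    (graft g none h).roots.ncard = g.roots.ncard + 1 := by
  have : (graft g none h).roots =
      insert ⊤ (toTop '' g.roots) := by
    ext v
    by_cases hv : v = ⊤
    · subst hv
      simp [roots, graft, graftParent_top]
    · rw [coe_mem_roots_graft_iff g none h v hv, Set.mem_insert_iff, or_iff_right hv]
  rw [this, Set.ncard_insert_of_notMem top_notMem_image_toTop (Set.toFinite _),
    Set.ncard_image_of_injective _ toTop_injective]

theorem ncard_roots_graft_some (u : U) :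
    (graft g (some u) h).roots.ncard = g.roots.ncard := by
  have : (graft g (some u) h).roots = toTop '' g.roots := by
    ext v
    by_cases hv : v = ⊤
    · subst hv
      exact iff_of_false (Option.some_ne_none _) top_notMem_image_toTop
    · rw [coe_mem_roots_graft_iff g (some u) h v hv]
  rw [this, Set.ncard_image_of_injective _ toTop_injective]

variable (W) in
/-- The data from which a parent map on `WithTop W` is assembled by `graft`. -/
abbrev GraftData : Type _ :=
  Σ U : Finset W, ParentMap U × Option U × ParentMap {w // w ∉ U}

theorem graft_injective :
    Function.Injective fun d : GraftData W => graft d.2.1 d.2.2.1 d.2.2.2 := by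
  rintro ⟨U, g, p, h⟩ ⟨U', g', p', h'⟩ heq
  have heq : graft g p h = graft g' p' h' := heq
  obtain rfl : U = U' := by
    ext w
    rw [← not_iff_not, ← descends_graft_top_iff g p h w, heq, descends_graft_top_iff]
  have hpar : graftParent g p h = graftParent g' p' h' := congrArg parent heq
  have hp : p = p' := by
    have := congrFun hpar ⊤
    rw [graftParent_top, graftParent_top] at this
    exact Option.map_injective toTop_injective this
  have hg : g = g' := by
    ext1
    funext u
    have := congrFun hpar (toTop u)
    rw [graftParent_mem, graftParent_mem] at this
    exact Option.map_injective toTop_injective this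
  have hh : h = h' := by
    ext1
    funext u
    have := congrFun hpar (toTop u)
    rw [graftParent_notMem, graftParent_notMem, Option.some_inj] at this
    rcases hx : h.parent u with _ | x <;> rcases hx' : h'.parent u with _ | x' <;>
      (rw [hx, hx'] at this)
    · exact absurd this.symm (toTop_ne_top x')
    · exact absurd this (toTop_ne_top x)
    · exact congrArg some (toTop_injective this)
  rw [hp, hg, hh]

theorem graft_surjective [Finite W] :
    Function.Surjective fun d : GraftData W => graft d.2.1 d.2.2.1 d.2.2.2 := by
  classical
  intro f
  have := Fintype.ofFinite W
  -- Non-descendants of `⊤` are closed under taking parents, the parent of `⊤` is one of them, and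
  -- the parent of a proper descendant is `⊤` or again a proper descendant.
  let U : Finset W := {w | ¬ f.Descends w ⊤}
  have hU : ∀ w, w ∈ U ↔ ¬ f.Descends w ⊤ := by simp [U]
  have htop : ∀ v, f.parent ⊤ = some v → ∃ u : U, (toTop u) = v := by
    intro v hv
    have hd := not_descends_of_parent hv
    induction v using WithTop.recTopCoe with
    | top => exact absurd (.refl _) hd
    | coe w => exact ⟨⟨w, (hU w).2 hd⟩, rfl⟩
  have hmem : ∀ (u : U) v, f.parent (toTop u) = some v →
      ∃ x : U, (toTop x) = v := by
    intro u v hv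
    have hd : ¬ f.Descends v ⊤ := fun h => (hU u).1 u.2 (.of_parent hv h)
    induction v using WithTop.recTopCoe with
    | top => exact absurd (.refl _) hd
    | coe w => exact ⟨⟨w, (hU w).2 hd⟩, rfl⟩
  have hnot : ∀ u : {w // w ∉ U}, ∃ x : Option {w // w ∉ U},
      f.parent (toTop u) = some (x.elim ⊤ toTop) := by
    intro u
    have hd : f.Descends (toTop u) ⊤ := by
      have := u.2
      rwa [hU, not_not] at this
    rcases hd.eq_or_exists with h | ⟨v, hv, hvt⟩
    · exact absurd h WithTop.coe_ne_top
    · induction v using WithTop.recTopCoe with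
      | top => exact ⟨none, hv⟩
      | coe w => exact ⟨some ⟨w, fun h => (hU w).1 h hvt⟩, hv⟩
  have hopt : ∀ o : Option (WithTop W),
      (∀ v, o = some v → ∃ u : U, (toTop u) = v) →
      ∃ x : Option U, x.map toTop = o := by
    rintro (_ | v) ho
    · exact ⟨none, rfl⟩
    · obtain ⟨u, hu⟩ := ho v rfl
      exact ⟨some u, congrArg some hu⟩
  obtain ⟨p, hp⟩ := hopt _ htop
  choose gp hgp using fun u => hopt _ (hmem u)
  choose hpar hhpar using hnot
  let g : ParentMap U :=
    { parent := gp
      wf := by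
        refine Subrelation.wf (r := InvImage (fun u v => f.parent v = some u)
          (toTop (P := (· ∈ U)))) ?_ (InvImage.wf _ f.wf)
        intro u v huv
        exact (hgp v).symm.trans (by rw [huv]; rfl) }
  let h : ParentMap {w // w ∉ U} :=
    { parent := hpar
      wf := by
        refine Subrelation.wf (r := InvImage (fun u v => f.parent v = some u)
          (toTop (P := (· ∉ U)))) ?_ (InvImage.wf _ f.wf)
        intro u v huv
        exact (hhpar v).trans (by rw [huv]; rfl) }
  refine ⟨⟨U, g, p, h⟩, ?_⟩
  ext1
  funext v
  change graftParent g p h v = f.parent v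
  induction v using WithTop.recTopCoe with
  | top => exact hp
  | coe w =>
    by_cases hw : w ∈ U
    · exact (graftParent_mem g p h ⟨w, hw⟩).trans (hgp ⟨w, hw⟩)
    · exact (graftParent_notMem g p h ⟨w, hw⟩).trans (hhpar ⟨w, hw⟩).symm

end Graft

end ParentMap

/-! ### Abel's identity -/

open Finset in
/-- Abel's binomial identity. -/
theorem abel_binomial (n : ℕ) (z : ℚ) :
    ∑ k ∈ range (n + 1), (n.choose k : ℚ) * (k + 1 : ℚ) ^ (k - 1) * (z - (k + 1)) ^ (n - k) =
      z ^ n := by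
  -- The `m`-th finite difference of `x ^ (m - 1)`, evaluated at 1, vanishes.
  have hdiff : ∀ m : ℕ, 0 < m →
      ∑ k ∈ range (m + 1), (m.choose k : ℚ) * (-1) ^ (m - k) * (k + 1 : ℚ) ^ (m - 1) = 0 := by
    intro m hm
    have h := congrFun (fwdDiff_iter_pow_eq_zero_of_lt (R := ℚ) (Nat.sub_lt hm one_pos)) 1
    rw [fwdDiff_iter_eq_sum_shift] at h
    rw [Pi.zero_apply] at h
    rw [← h]
    refine sum_congr rfl fun k _ => ?_
    simp only [zsmul_eq_mul, nsmul_eq_mul, mul_one]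
    push_cast
    ring
  -- Expand in powers of `z`. The coefficient of `z ^ j` is, up to a factor, the sum in `hdiff` with
  -- `m = n - j`, so only `j = n` survives.
  have hexp : ∀ k ∈ range (n + 1),
      (n.choose k : ℚ) * (k + 1 : ℚ) ^ (k - 1) * (z - (k + 1)) ^ (n - k) =
        ∑ j ∈ range (n + 1), (if k + j ≤ n then
          z ^ j * (n.choose j * ((n - j).choose k * (-1) ^ (n - j - k) *
            (k + 1 : ℚ) ^ (k - 1 + (n - j - k))))
          else 0 : ℚ) := by
    intro k hk
    have hk : k ≤ n := by simpa [Nat.lt_succ_iff] using hk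
    rw [← sum_filter, sub_eq_add_neg, add_pow z, mul_sum]
    have hr : (range (n + 1)).filter (fun j => k + j ≤ n) = range (n - k + 1) := by
      ext j; simp; omega
    rw [hr]
    refine Finset.sum_congr rfl ?_
    intro j hj
    have hj : j ≤ n - k := by simpa [Nat.lt_succ_iff] using hj
    have hc : (n.choose k : ℚ) * (n - k).choose j = n.choose j * (n - j).choose k := by
      have h₁ := Nat.choose_mul (n := n) (k := k + j) (s := k) (by omega)
      have h₂ := Nat.choose_mul (n := n) (k := k + j) (s := j) (by omega)
      have h₃ := Nat.choose_symm_add (a := k) (b := j)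
      rw [Nat.add_sub_cancel_left] at h₁
      rw [Nat.add_sub_cancel] at h₂
      rw [← h₃, h₁] at h₂
      exact_mod_cast h₂
    rw [neg_pow, show n - k - j = n - j - k by omega, pow_add]
    linear_combination (z ^ j * (-1) ^ (n - j - k) * (k + 1 : ℚ) ^ (k - 1) *
      (k + 1 : ℚ) ^ (n - j - k)) * hc
  rw [sum_congr rfl hexp, sum_comm, sum_range_succ, sum_eq_zero, zero_add]
  · rw [← sum_filter]
    have hr : (range (n + 1)).filter (fun k => k + n ≤ n) = {0} := by
      ext j; simp
    rw [hr]
    simp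
  · intro j hj
    have hj : j < n := by simpa using hj
    have hr : (range (n + 1)).filter (fun k => k + j ≤ n) = range (n - j + 1) := by
      ext j; simp; omega
    rw [← sum_filter, hr, ← mul_sum, ← mul_sum]
    have h := hdiff (n - j) (by omega)
    rw [sum_congr rfl fun k hk => ?_, h, mul_zero, mul_zero]
    have hk : k ≤ n - j := by simpa [Nat.lt_succ_iff] using hk
    -- At `k = 0` the truncated exponents disagree, but the base is 1.
    rcases k with _ | k
    · simp
    · congr 2
      omega

/-! ### Weighted recursion and the number of rooted forests -/

namespace ParentMap

noncomputable instance fintype (V : Type*) [Finite V] : Fintype (ParentMap V) :=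
  Fintype.ofFinite _

/-- The sum over all parent maps on `V` of a weight depending on the number of records and the
number of roots. -/
noncomputable def weightSum (V : Type*) [LinearOrder V] [Finite V] (ω : ℕ → ℕ → ℚ) : ℚ :=
  ∑ f : ParentMap V, ω f.records.ncard f.roots.ncard

theorem weightSum_congr {V W : Type*} [LinearOrder V] [Finite V] [LinearOrder W] [Finite W]
    (e : V ≃o W) (ω : ℕ → ℕ → ℚ) : weightSum V ω = weightSum W ω := by
  refine Fintype.sum_equiv (congr e.toEquiv) _ _ fun f => ?_
  change _ = ω (f.map e.toEquiv).records.ncard (f.map e.toEquiv).roots.ncard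
  rw [records_map, roots_map, Set.ncard_image_of_injective _ e.injective,
    Set.ncard_image_of_injective _ e.toEquiv.injective]

theorem weightSum_one (V : Type*) [LinearOrder V] [Finite V] :
    weightSum V (fun _ _ => 1) = Nat.card (ParentMap V) := by
  simp [weightSum, Nat.card_eq_fintype_card]

/-- The `U.card` ways to attach `⊤` to a vertex of `U` preserve the number of roots; making `⊤` a
root adds one. A general `ω` lets one recursion serve forests, trees and the plain count. -/
theorem weightSum_withTop (W : Type*) [LinearOrder W] [Fintype W] (ω : ℕ → ℕ → ℚ) :
    weightSum (WithTop W) ω =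
      ∑ U : Finset W, weightSum U (fun a b => U.card * ω (a + 1) b + ω (a + 1) (b + 1)) *
        Nat.card (ParentMap {w // w ∉ U}) := by
  have h := Function.Bijective.sum_comp ⟨graft_injective (W := W), graft_surjective⟩
    fun f => ω f.records.ncard f.roots.ncard
  refine h.symm.trans ?_
  rw [Fintype.sum_sigma]
  refine Finset.sum_congr rfl fun U _ => ?_
  rw [Fintype.sum_prod_type, weightSum, Finset.sum_mul]
  refine Finset.sum_congr rfl fun g _ => ?_
  simp only [Fintype.sum_prod_type, Fintype.sum_option,
    ncard_records_graft, ncard_roots_graft_none, ncard_roots_graft_some, Finset.sum_const,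
    Finset.card_univ, Nat.card_eq_fintype_card, Fintype.card_coe, nsmul_eq_mul]
  ring

theorem weightSum_eq_fin {V : Type*} [LinearOrder V] [Fintype V] {n : ℕ}
    (h : Fintype.card V = n) (ω : ℕ → ℕ → ℚ) : weightSum V ω = weightSum (Fin n) ω :=
  (weightSum_congr (Fintype.orderIsoFinOfCardEq V h) ω).symm

theorem card_eq_fin {V : Type*} [Fintype V] {n : ℕ} (h : Fintype.card V = n) :
    Nat.card (ParentMap V) = Nat.card (ParentMap (Fin n)) :=
  Nat.card_congr (congr (Fintype.equivFinOfCardEq h))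

theorem weightSum_fin_succ (n : ℕ) (ω : ℕ → ℕ → ℚ) :
    weightSum (Fin (n + 1)) ω =
      ∑ i ∈ Finset.range (n + 1), (n.choose i : ℚ) *
        (weightSum (Fin i) (fun a b => i * ω (a + 1) b + ω (a + 1) (b + 1)) *
          Nat.card (ParentMap (Fin (n - i)))) := by
  rw [← weightSum_eq_fin (V := WithTop (Fin n)) 
    ((Fintype.card_congr (Equiv.refl (Option (Fin n)))).trans (by simp)), weightSum_withTop]
  rw [← Finset.powerset_univ]
  have h := Finset.sum_powerset_apply_card (x := (Finset.univ : Finset (Fin n))) fun i =>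
    (weightSum (Fin i) (fun a b => i * ω (a + 1) b + ω (a + 1) (b + 1)) *
          Nat.card (ParentMap (Fin (n - i))) : ℚ)
  rw [Finset.card_univ, Fintype.card_fin] at h
  simp only [nsmul_eq_mul] at h
  rw [← h]
  refine Finset.sum_congr rfl fun U _ => ?_
  rw [weightSum_eq_fin (V := U) (Fintype.card_coe U), card_eq_fin (n := n - U.card)]
  rw [Fintype.card_subtype_compl]
  simp

theorem weightSum_fin_zero (ω : ℕ → ℕ → ℚ) : weightSum (Fin 0) ω = ω 0 0 := by
  have : Unique (ParentMap (Fin 0)) :=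
    { default := ⟨finZeroElim, ⟨finZeroElim⟩⟩
      uniq := fun f => by ext1; funext v; exact v.elim0 }
  rw [weightSum, Fintype.sum_unique]
  congr 1 <;> rw [Set.ncard_eq_zero] <;> exact Set.eq_empty_of_isEmpty _

/-- The number of rooted forests on `n` labelled vertices. -/
theorem card_fin (n : ℕ) : (Nat.card (ParentMap (Fin n)) : ℚ) = (n + 1 : ℚ) ^ (n - 1) := by
  induction n using Nat.strong_induction_on with
  | _ n ih =>
    rcases n with _ | n
    · rw [← weightSum_one, weightSum_fin_zero]
      simp
    · rw [← weightSum_one, weightSum_fin_succ, ← Finset.sum_range_reflect]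
      -- After reflection, `k` counts the proper descendants of `⊤`, and `z = n + 2` turns `z - (k +
      -- 1)` into `(n - k) + 1`.
      have h := abel_binomial n (n + 2)
      rw [Nat.add_sub_cancel, show ((n + 1 : ℕ) + 1 : ℚ) = n + 2 by push_cast; ring, ← h]
      refine Finset.sum_congr rfl fun k hk => ?_
      have hk : k ≤ n := by simpa [Nat.lt_succ_iff] using hk
      rw [show n - (n - k) = k by omega,
        Nat.choose_symm hk, ih k (by omega)]
      have h₁ : weightSum (Fin (n - k)) (fun _ _ => ((n - k : ℕ) : ℚ) * 1 + 1) =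
          (((n - k : ℕ) : ℚ) + 1) ^ (n - k) := by
        have h₂ := ih (n - k) (by omega)
        rw [← weightSum_one] at h₂
        have h₃ : weightSum (Fin (n - k)) (fun _ _ => ((n - k : ℕ) : ℚ) * 1 + 1) =
            (((n - k : ℕ) : ℚ) + 1) * weightSum (Fin (n - k)) (fun _ _ => 1) := by
          simp only [weightSum, Finset.mul_sum, mul_one]
        rw [h₃, h₂]
        rcases Nat.eq_zero_or_pos (n - k) with h0 | h0
        · simp [h0]
        · rw [← pow_succ', Nat.sub_add_cancel h0]
      rw [h₁, Nat.cast_sub hk]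
      rw [show (n + 2 : ℚ) - (k + 1) = n - k + 1 by ring]
      ring

/-- The integer exponent matters at `i = n`, where it is `-1` while the truncated one is 0; both
powers have base 1. -/
theorem cast_card_fin_sub {n i : ℕ} (h : i ≤ n) :
    (Nat.card (ParentMap (Fin (n - i))) : ℚ) =
      (((n + 1 : ℕ) : ℚ) - i) ^ (((n + 1 : ℕ) : ℤ) - i - 2) := by
  rw [card_fin, Nat.cast_sub h, show (n : ℚ) - i + 1 = ((n + 1 : ℕ) : ℚ) - i by push_cast; ring]
  rcases Nat.eq_or_lt_of_le h with rfl | h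
  · simp
  · rw [← zpow_natCast]
    congr 1
    omega

theorem one_le_ncard_records {n : ℕ} (f : ParentMap (Fin (n + 1))) : 1 ≤ f.records.ncard :=
  (Set.ncard_pos (Set.toFinite _)).2 ⟨Fin.last n, fun u _ => Fin.le_last u⟩

theorem ncard_records_le {n : ℕ} (f : ParentMap (Fin n)) : f.records.ncard ≤ n :=
  (Set.ncard_le_card _).trans_eq (by simp)

theorem ncard_roots_pos {n : ℕ} (f : ParentMap (Fin (n + 1))) : f.roots.ncard ≠ 0 :=
  let ⟨r, hr, _⟩ := f.exists_root 0
  ((Set.ncard_pos (Set.toFinite _)).2 ⟨r, hr⟩).ne'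

end ParentMap

/-! ### Record numbers -/

open ParentMap

theorem forestRecordNumber_eq_weightSum (n k : ℕ) :
    (forestRecordNumber n k : ℚ) =
      weightSum (Fin n) fun a _ => if a = k then 1 else 0 := by
  classical
  rw [forestRecordNumber_eq_card, weightSum, Nat.card_eq_fintype_card, Fintype.card_subtype,
    Finset.sum_boole]

theorem treeRecordNumber_eq_weightSum (n k : ℕ) :
    (treeRecordNumber n k : ℚ) =
      weightSum (Fin n) fun a b => if a = k ∧ b = 1 then 1 else 0 := by
  classical
  rw [treeRecordNumber_eq_card, weightSum, Nat.card_eq_fintype_card, Fintype.card_subtype,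
    Finset.sum_boole]

theorem forestRecordNumber_eq_zero {n k : ℕ} (h : ¬ (1 ≤ n ∧ 1 ≤ k ∧ k ≤ n))
    (h' : ¬ (n = 0 ∧ k = 0)) : forestRecordNumber n k = 0 := by
  rw [forestRecordNumber_eq_card, Nat.card_eq_zero]
  refine Or.inl ⟨fun ⟨f, hf⟩ => ?_⟩
  have h₁ := f.ncard_records_le
  rcases n with _ | n
  · omega
  · have h₂ := f.one_le_ncard_records
    omega

theorem treeRecordNumber_eq_zero {n k : ℕ} (h : ¬ (1 ≤ n ∧ 1 ≤ k ∧ k ≤ n)) :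
    treeRecordNumber n k = 0 := by
  rw [treeRecordNumber_eq_card, Nat.card_eq_zero]
  refine Or.inl ⟨fun ⟨f, hf, hr⟩ => ?_⟩
  have h₁ := f.ncard_records_le
  rcases n with _ | n
  · have : f.roots = ∅ := Set.eq_empty_of_isEmpty _
    simp [this] at hr
  · have h₂ := f.one_le_ncard_records
    omega

theorem forestRecordNumber_succ (n k : ℕ) :
    (forestRecordNumber (n + 1) (k + 1) : ℚ) =
      ∑ i ∈ Finset.range (n + 1), (n.choose i : ℚ) * (forestRecordNumber i k : ℚ) *
        (((n + 1 : ℕ) : ℚ) - i) ^ (((n + 1 : ℕ) : ℤ) - i - 2) * (i + 1) := by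
  rw [forestRecordNumber_eq_weightSum, weightSum_fin_succ]
  refine Finset.sum_congr rfl fun i hi => ?_
  rw [← cast_card_fin_sub (Nat.lt_succ_iff.1 (Finset.mem_range.1 hi)),
    forestRecordNumber_eq_weightSum]
  have h : weightSum (Fin i) (fun a _ =>
      (i : ℚ) * (if a + 1 = k + 1 then 1 else 0) + if a + 1 = k + 1 then 1 else 0) =
      (i + 1) * weightSum (Fin i) fun a _ => if a = k then 1 else 0 := by
    simp only [weightSum, Finset.mul_sum, Nat.add_right_cancel_iff]
    exact Finset.sum_congr rfl fun f _ => by ring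
  rw [h]
  ring

theorem treeRecordNumber_succ (n k : ℕ) (hk : k ≠ 0) :
    (treeRecordNumber (n + 1) (k + 1) : ℚ) =
      ∑ i ∈ Finset.range (n + 1), (n.choose i : ℚ) * (treeRecordNumber i k : ℚ) *
        (((n + 1 : ℕ) : ℚ) - i) ^ (((n + 1 : ℕ) : ℤ) - i - 2) * i := by
  rw [treeRecordNumber_eq_weightSum, weightSum_fin_succ]
  refine Finset.sum_congr rfl fun i hi => ?_
  rw [← cast_card_fin_sub (Nat.lt_succ_iff.1 (Finset.mem_range.1 hi)),
    treeRecordNumber_eq_weightSum]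
  have h : weightSum (Fin i) (fun a b =>
      (i : ℚ) * (if a + 1 = k + 1 ∧ b = 1 then 1 else 0) +
        if a + 1 = k + 1 ∧ b + 1 = 1 then 1 else 0) =
      i * weightSum (Fin i) fun a b => if a = k ∧ b = 1 then 1 else 0 := by
    -- A root at `⊤` gives a tree only if the forest on `U` has no roots, hence `i = 0`; that forest
    -- has 0 records, excluded by `k ≠ 0`.
    rcases i with _ | i
    · simp [weightSum_fin_zero, hk.symm]
    · simp only [weightSum, Finset.mul_sum, Nat.add_right_cancel_iff]
      refine Finset.sum_congr rfl fun f _ => ?_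
      simp [f.ncard_roots_pos]
  rw [h]
  ring

/-- A nonempty `U` would contribute a second record, so only `i = 0` remains: `⊤` is the root, above
an arbitrary forest. -/
theorem treeRecordNumber_succ_one (n : ℕ) :
    (treeRecordNumber (n + 1) 1 : ℚ) = ((n + 1 : ℕ) : ℚ) ^ (((n + 1 : ℕ) : ℤ) - 2) := by
  rw [treeRecordNumber_eq_weightSum, weightSum_fin_succ, Finset.sum_eq_single 0]
  · rw [weightSum_fin_zero, cast_card_fin_sub (Nat.zero_le n)]
    simp
  · intro i _ hi
    obtain ⟨i, rfl⟩ := Nat.exists_eq_succ_of_ne_zero hi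
    have h : weightSum (Fin (i + 1)) (fun a b =>
        ((i + 1 : ℕ) : ℚ) * (if a + 1 = 1 ∧ b = 1 then 1 else 0) +
          if a + 1 = 1 ∧ b + 1 = 1 then 1 else 0) = 0 := by
      refine Finset.sum_eq_zero fun f _ => ?_
      have h₁ : f.records.ncard ≠ 0 := Nat.one_le_iff_ne_zero.1 f.one_le_ncard_records
      simp [h₁]
    rw [h, zero_mul, mul_zero]
  · simp

theorem sum_range_eq_sum_Icc {n k : ℕ} {F : ℕ → ℚ} (h : ∀ i < k, F i = 0) :
    ∑ i ∈ Finset.range (n + 1), F i = ∑ i ∈ Finset.Icc k n, F i := by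
  symm
  refine Finset.sum_subset (fun i hi => ?_) fun i hi hi' => h i ?_
  · simp only [Finset.mem_Icc, Finset.mem_range] at *
    omega
  · simp only [Finset.mem_Icc, Finset.mem_range] at *
    omega

theorem mainTheorem8 :
    -- tree record numbers
    ((∀ n k : ℕ, 1 ≤ n → 2 ≤ k → k ≤ n →
        (treeRecordNumber n k : ℚ) =
          ∑ i ∈ Finset.Icc (k - 1) (n - 1),
            ((n - 1).choose i : ℚ) * (treeRecordNumber i (k - 1) : ℚ) *
              ((n : ℚ) - (i : ℚ)) ^ ((n : ℤ) - (i : ℤ) - 2) * (i : ℚ)) ∧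
      (∀ n : ℕ, 1 ≤ n → (treeRecordNumber n 1 : ℚ) = (n : ℚ) ^ ((n : ℤ) - 2)) ∧
      (∀ n k : ℕ, ¬ (1 ≤ n ∧ 2 ≤ k ∧ k ≤ n) → ¬ (1 ≤ n ∧ k = 1) →
        treeRecordNumber n k = 0)) ∧
    -- forest record numbers
    ((∀ n k : ℕ, 1 ≤ n → 1 ≤ k → k ≤ n →
        (forestRecordNumber n k : ℚ) =
          ∑ i ∈ Finset.Icc (k - 1) (n - 1),
            ((n - 1).choose i : ℚ) * (forestRecordNumber i (k - 1) : ℚ) *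
              ((n : ℚ) - (i : ℚ)) ^ ((n : ℤ) - (i : ℤ) - 2) * ((i : ℚ) + 1)) ∧
      forestRecordNumber 0 0 = 1 ∧
      (∀ n k : ℕ, ¬ (1 ≤ n ∧ 1 ≤ k ∧ k ≤ n) → ¬ (n = 0 ∧ k = 0) →
        forestRecordNumber n k = 0)) := by
  refine ⟨⟨?_, ?_, ?_⟩, ?_, ?_, ?_⟩
  · intro n k hn hk _
    obtain ⟨n, rfl⟩ := Nat.exists_eq_add_of_le' hn
    obtain ⟨k, rfl⟩ := Nat.exists_eq_add_of_le' (one_le_two.trans hk)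
    rw [Nat.add_sub_cancel, Nat.add_sub_cancel, treeRecordNumber_succ n k (by omega)]
    refine sum_range_eq_sum_Icc fun i hi => ?_
    rw [treeRecordNumber_eq_zero (by omega)]
    simp
  · intro n hn
    obtain ⟨n, rfl⟩ := Nat.exists_eq_add_of_le' hn
    exact treeRecordNumber_succ_one n
  · intro n k h h'
    exact treeRecordNumber_eq_zero (by omega)
  · intro n k hn hk _
    obtain ⟨n, rfl⟩ := Nat.exists_eq_add_of_le' hn
    obtain ⟨k, rfl⟩ := Nat.exists_eq_add_of_le' hk
    rw [Nat.add_sub_cancel, Nat.add_sub_cancel, forestRecordNumber_succ n k]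
    refine sum_range_eq_sum_Icc fun i hi => ?_
    rw [forestRecordNumber_eq_zero (by omega) (by omega)]
    simp
  · have h := forestRecordNumber_eq_weightSum 0 0
    rw [weightSum_fin_zero] at h
    exact_mod_cast h
  · intro n k h h'
    exact forestRecordNumber_eq_zero h h'
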